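/- Let $\mathcal H$ be the upper half plane and $\mathrm{Hol}$ the space of holomorphic functions on $\mathcal H$. Write $f'=\frac{1}{2\pi i}\frac{df}{dz}$, let $E_2,E_4,E_6$ be the normalized Eisenstein series of $\mathrm{SL}(2,\mathbb Z)$, put $D_kf=f'-\frac{k}{12}E_2f$ for $k\in\mathbb R$, and $D_k^{[0]}=1$, $D_k^{[n]}=D_{k+2n-2}\cdots D_{k+2}D_k$. A monic modular linear differential equation (monic MLDE) of weight $k$ is an equation $$D_k^{[n]}f+g_1D_k^{[n-1]}f+\cdots+g_{n-1}D_kf+g_nf=0$$ with $n\ge 0$, where each $g_i$ is a holomorphic modular form of weight $2i$ on $\mathrm{SL}(2,\mathbb Z)$. Let $\Sigma_k$ be the set of $f\in\mathrm{Hol}$ satisfying some monic MLDE of weight $k$. For $f\in\mathrm{Hol}$ let $\mathrm{dwt}(f)\in\mathbb Z\cup\{\pm\infty\}$ be the largest $k\in\mathbb Z$ with $f\in\Sigma_k$; here $\mathrm{dwt}(f)=\infty$ if the set of such integers $k$ is unbounded above, and $\mathrm{dwt}(f)=-\infty$ if it is empty. A quasimodular form of weight $k$ and depth $s$ is a function $P(E_2,E_4,E_6)$,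 where $P$ is a complex polynomial that is homogeneous of weight $k$ when its variables are given the weights $2,4,6$, and that has degree $s$ in the first variable. **Theorem.** Let $f,g\in\mathrm{Hol}$. 1. $\mathrm{dwt}(fg)\ge\mathrm{dwt}(f)+\mathrm{dwt}(g)$, where $\infty+(-\infty):=-\infty$. 2. If $\mathrm{dwt}(f)=\mathrm{dwt}(g)$, then $\mathrm{dwt}(f+g)\ge\mathrm{dwt}(g)$. 3. If $\mathrm{dwt}(f)>\mathrm{dwt}(g)$, then $\mathrm{dwt}(f+g)=\mathrm{dwt}(g)$. 4. If $f$ is a nonzero quasimodular form of weight $k$ and depth $s$, then $\mathrm{dwt}(f)=k-s$; in particular $f$ satisfies a monic MLDE of weight $k-s$, and satisfies none of any integral weight $m>k-s$. -/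

import Mathlib

open scoped MatrixGroups Manifold
open UpperHalfPlane

noncomputable section

namespace MLDE

/-- The iterated Ramanujan-Serre derivative `D_{k+2n-2} ∘ ⋯ ∘ D_{k+2} ∘ D_k`, where
`D_k f = (2πi)⁻¹ df/dz - (k/12) E₂ f`. -/
def iterSerre (k : ℝ) : ℕ → (ℍ → ℂ) → (ℍ → ℂ)
  | 0, f => f
  | n + 1, f => Derivative.serreDerivative ((k + 2 * n : ℝ) : ℂ) (iterSerre k n f)

/-- `f` solves a monic modular linear differential equation of weight `k` and order `n`:
`D^n f + g₁ D^{n-1} f + ⋯ + gₙ f = 0` with `gᵢ` a holomorphic modular form of weight `2i` on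
`SL(2, ℤ)` (only `g 1, …, g n` are used). -/
def SolvesMonicMLDE (k : ℝ) (n : ℕ) (f : ℍ → ℂ) : Prop :=
  ∃ g : (i : ℕ) → ModularForm 𝒮ℒ (2 * (i : ℤ)),
    ∀ z : ℍ, iterSerre k n f z + ∑ i ∈ Finset.Icc 1 n, g i z * iterSerre k (n - i) f z = 0

/-- `Σ_k`: the holomorphic functions on the upper half plane that satisfy some monic modular
linear differential equation of weight `k`. -/
def SigmaSet (k : ℝ) : Set (ℍ → ℂ) :=
  {f | MDiff f ∧ ∃ n : ℕ, SolvesMonicMLDE k n f}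

/-- The differential weight, with values in `ℤ ∪ {-∞, ∞}`: the largest integer `k` with
`f ∈ Σ_k`, which is `-∞` (`⊥`) if there is no such integer and `∞` (`⊤`) if such integers are
unbounded above. Addition on `WithBot (WithTop ℤ)` satisfies `⊤ + ⊥ = ⊥`. -/
def dwt (f : ℍ → ℂ) : WithBot (WithTop ℤ) :=
  sSup {x | ∃ k : ℤ, f ∈ SigmaSet (k : ℝ) ∧ x = ((k : WithTop ℤ) : WithBot (WithTop ℤ))}

theorem dwt_eq_bot_iff (f : ℍ → ℂ) : dwt f = ⊥ ↔ ∀ k : ℤ, f ∉ SigmaSet (k : ℝ) := by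
  simp only [dwt, sSup_eq_bot, Set.mem_ofPred_eq]
  constructor
  · intro h k hk
    exact WithBot.coe_ne_bot (h _ ⟨k, hk, rfl⟩)
  · rintro h x ⟨k, hk, -⟩
    exact absurd hk (h k)

theorem dwt_eq_coe_iff (f : ℍ → ℂ) (k : ℤ) :
    dwt f = ((k : WithTop ℤ) : WithBot (WithTop ℤ)) ↔
      IsGreatest {m : ℤ | f ∈ SigmaSet (m : ℝ)} k := by
  constructor
  · intro h
    have hub : ∀ m : ℤ, f ∈ SigmaSet (m : ℝ) → m ≤ k := by
      intro m hm
      have : ((m : WithTop ℤ) : WithBot (WithTop ℤ)) ≤ dwt f := le_sSup ⟨m, hm, rfl⟩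
      rw [h] at this
      exact_mod_cast this
    refine ⟨?_, fun m hm => hub m hm⟩
    by_contra hk
    have hle : dwt f ≤ (((k - 1 : ℤ) : WithTop ℤ) : WithBot (WithTop ℤ)) := by
      refine sSup_le ?_
      rintro x ⟨m, hm, rfl⟩
      have h1 := hub m hm
      have h2 : m ≠ k := by
        rintro rfl
        exact hk hm
      have h3 : m ≤ k - 1 := by omega
      exact_mod_cast h3
    rw [h] at hle
    have : k ≤ k - 1 := by exact_mod_cast hle
    omega
  · rintro ⟨hk, hub⟩
    refine le_antisymm (sSup_le ?_) (le_sSup ⟨k, hk, rfl⟩)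
    rintro x ⟨m, hm, rfl⟩
    exact_mod_cast hub hm

/-- `f` is a quasimodular form of weight `k` and depth `s`: it is `P(E₂, E₄, E₆)` for a complex
polynomial `P`, homogeneous of weight `k` when the variables have weights `2, 4, 6`, whose degree
in the first variable is `s`. -/
def IsQuasimodular (k s : ℕ) (f : ℍ → ℂ) : Prop :=
  ∃ P : MvPolynomial (Fin 3) ℂ,
    P.IsWeightedHomogeneous (![2, 4, 6] : Fin 3 → ℕ) k ∧ P.degreeOf 0 = s ∧
      ∀ z : ℍ, f z =
        MvPolynomial.eval ![EisensteinSeries.E2 z, ModularForm.E₄ z, ModularForm.E₆ z] P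

end MLDE

end

/-! A function satisfies a monic MLDE of weight `k` exactly when it lies in degree zero of a
finitely generated graded module of holomorphic functions over the ring of level one modular forms
that is stable under Serre derivatives of weight `k`, `k + 2`, … on its graded parts. The iterated
derivatives that precede the leading one in an MLDE generate such a module. Conversely, since
`ℂ[E₄, E₆]` is Noetherian, in such a module some derivative is a combination of the previous ones,
and the coefficients may be taken homogeneous. Sums and products of functions live in sums and
tensor products of these modules.

The powers `1, E₂, …, E₂ ^ s` generate such a module of weight `-s`, because `D₁ E₂` is a modular
form. This handles quasimodular forms, and also shows that `1` satisfies an MLDE of every weight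
`-n`, so that weights can be lowered by natural numbers. Finally, if `f` has weight `k` and depth
`s`, then the `n`-th step of the iterated derivative of weight `m` raises the depth by one and
multiplies the coefficient of the top power of `E₂` by `(k - s - n - m) / 12`. An MLDE forces one of
these factors to vanish. -/

noncomputable section

namespace MLDE

open Derivative EisensteinSeries ModularForm

section GradedAlgebra

theorem exists_mem_span_image_range {R V : Type*} [Ring R] [AddCommGroup V] [Module R V]
    [IsNoetherian R V] (v : ℕ → V) :
    ∃ n, v n ∈ Submodule.span R (v '' (Finset.range n : Set ℕ)) := by
  let N : ℕ →o Submodule R V := ⟨fun n ↦ Submodule.span R (v '' (Finset.range n : Set ℕ)),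
    fun m n hmn ↦ Submodule.span_mono (Set.image_mono (by simpa using hmn))⟩
  obtain ⟨n, hn⟩ := monotone_stabilizes_iff_noetherian.mpr ‹IsNoetherian R V› N
  have hsucc : N n = N (n + 1) := hn (n + 1) n.le_succ
  refine ⟨n, ?_⟩
  change v n ∈ N n
  rw [hsucc]
  exact Submodule.subset_span ⟨n, by simp, rfl⟩

theorem exists_homogeneous_recurrence {A σ G ι : Type*} [Ring A] [IsNoetherianRing A]
    [SetLike σ A] [AddSubmonoidClass σ A] [AddGroup G] [DecidableEq G] (𝒜 : G → σ)
    [GradedRing 𝒜] [Finite ι] {d : ℕ → G} {w : ι → G} {v : ℕ → ι → A}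
    (hv : ∀ n i, v n i ∈ 𝒜 (d n - w i)) :
    ∃ n, ∃ q : ℕ → A, (∀ j, q j ∈ 𝒜 (d n - d j)) ∧
      ∀ i, v n i = ∑ j ∈ Finset.range n, q j * v j i := by
  obtain ⟨n, hn⟩ := exists_mem_span_image_range (R := A) v
  obtain ⟨r, hr⟩ := (Submodule.mem_span_image_finset_iff_exists_fun' A).mp hn
  refine ⟨n, fun j ↦ DirectSum.decompose 𝒜 (r j) (d n - d j), fun j ↦ SetLike.coe_mem _,
    fun i ↦ ?_⟩
  have hcomponent (j : ℕ) :
      (DirectSum.decompose 𝒜 (r j * v j i) (d n - w i) : A) =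
        DirectSum.decompose 𝒜 (r j) (d n - d j) * v j i := by
    rw [← sub_add_sub_cancel (d n) (d j) (w i),
      DirectSum.coe_decompose_mul_add_of_right_mem 𝒜 (hv j i)]
  have hri : ∑ j ∈ Finset.range n, r j * v j i = v n i := by
    simpa only [Finset.sum_apply, Pi.smul_apply, smul_eq_mul] using congrFun hr i
  rw [← DirectSum.decompose_of_mem_same 𝒜 (hv n i), ← hri, DirectSum.decompose_sum,
    DFinsupp.finsetSum_apply, AddSubmonoidClass.coe_finsetSum]
  exact Finset.sum_congr rfl fun j _ ↦ hcomponent j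

variable {R A G ι κ : Type*} [CommSemiring R] [CommSemiring A] [Algebra R A] [AddCommGroup G]
  [Fintype ι] [Fintype κ]

/-- The degree `k` part of the graded module generated over the graded family `𝒜` by elements
`u i` placed in degree `w i`. The generators are arbitrary elements of `A`, so the degrees `w i`
are additional data and the parts of different degrees may intersect. -/
def gradedSpan (𝒜 : G → Submodule R A) (u : ι → A) (w : ι → G) (k : G) : Submodule R A where
  carrier := {f | ∃ c : ι → A, (∀ i, c i ∈ 𝒜 (k - w i)) ∧ ∑ i, c i * u i = f}
  add_mem' := by
    rintro _ _ ⟨c, hc, rfl⟩ ⟨d, hd, rfl⟩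
    exact ⟨c + d, fun i ↦ add_mem (hc i) (hd i), by simp [add_mul, Finset.sum_add_distrib]⟩
  zero_mem' := ⟨0, fun i ↦ zero_mem _, by simp⟩
  smul_mem' := by
    rintro a _ ⟨c, hc, rfl⟩
    exact ⟨a • c, fun i ↦ Submodule.smul_mem _ a (hc i), by simp [Finset.smul_sum]⟩

variable {𝒜 : G → Submodule R A} {u : ι → A} {v : κ → A} {w : ι → G} {x : κ → G} {k l m : G}
  {a f g : A}

theorem mul_generator_mem_gradedSpan (i : ι) (ha : a ∈ 𝒜 l) (h : l + w i = k) :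
    a * u i ∈ gradedSpan 𝒜 u w k := by
  classical
  refine ⟨Pi.single i a, fun j ↦ ?_, ?_⟩
  · rcases eq_or_ne j i with rfl | hji
    · rwa [Pi.single_eq_same, ← h, add_sub_cancel_right]
    · rw [Pi.single_eq_of_ne hji]
      exact zero_mem _
  · rw [Finset.sum_eq_single_of_mem i (Finset.mem_univ i) fun j _ hji ↦ by
      rw [Pi.single_eq_of_ne hji, zero_mul], Pi.single_eq_same]

@[elab_as_elim]
theorem gradedSpan_induction {motive : (f : A) → f ∈ gradedSpan 𝒜 u w k → Prop}
    (mul : ∀ i c, ∀ hc : c ∈ 𝒜 (k - w i),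
      motive (c * u i) (mul_generator_mem_gradedSpan i hc (sub_add_cancel k (w i))))
    (zero : motive 0 (zero_mem _))
    (add : ∀ f g hf hg, motive f hf → motive g hg → motive (f + g) (add_mem hf hg))
    (hf : f ∈ gradedSpan 𝒜 u w k) : motive f hf := by
  suffices h : ∃ hf, motive f hf from h.2
  obtain ⟨c, hc, rfl⟩ := hf
  exact Finset.sum_induction _ (fun f ↦ ∃ hf, motive f hf)
    (fun f g ⟨hf, hf'⟩ ⟨hg, hg'⟩ ↦ ⟨_, add f g hf hg hf' hg'⟩) ⟨_, zero⟩
    fun i _ ↦ ⟨_, mul i (c i) (hc i)⟩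

theorem gradedSpan_comp_le (e : ι → κ) :
    gradedSpan 𝒜 (v ∘ e) (x ∘ e) k ≤ gradedSpan 𝒜 v x k := by
  intro f hf
  induction hf using gradedSpan_induction with
  | mul i c hc => exact mul_generator_mem_gradedSpan (e i) hc (sub_add_cancel k (x (e i)))
  | zero => exact zero_mem _
  | add f g _ _ hf hg => exact add_mem hf hg

variable [SetLike.GradedMonoid 𝒜]

theorem generator_mem_gradedSpan (i : ι) : u i ∈ gradedSpan 𝒜 u w (w i) := by
  simpa only [one_mul] using mul_generator_mem_gradedSpan i (SetLike.GradedOne.one_mem (A := 𝒜))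
    (zero_add (w i))

theorem mul_mem_gradedSpan (ha : a ∈ 𝒜 l) (hf : f ∈ gradedSpan 𝒜 u w k) (h : l + k = m) :
    a * f ∈ gradedSpan 𝒜 u w m := by
  induction hf using gradedSpan_induction with
  | mul i c hc =>
    rw [← mul_assoc]
    exact mul_generator_mem_gradedSpan i (SetLike.mul_mem_graded ha hc) (by rw [← h]; abel)
  | zero => simp
  | add f g _ _ hf hg =>
    rw [mul_add]
    exact add_mem hf hg

theorem mul_mem_gradedSpan_prod (hf : f ∈ gradedSpan 𝒜 u w k) (hg : g ∈ gradedSpan 𝒜 v x l)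
    (h : k + l = m) :
    f * g ∈ gradedSpan 𝒜 (fun i : ι × κ ↦ u i.1 * v i.2) (fun i ↦ w i.1 + x i.2) m := by
  induction hf using gradedSpan_induction with
  | mul i c hc =>
    induction hg using gradedSpan_induction with
    | mul j d hd =>
      rw [mul_mul_mul_comm]
      exact mul_generator_mem_gradedSpan (u := fun i : ι × κ ↦ u i.1 * v i.2) (i, j)
        (SetLike.mul_mem_graded hc hd) (by rw [← h]; abel)
    | zero => simp
    | add g g' _ _ hg hg' =>
      rw [mul_add]
      exact add_mem hg hg'
  | zero => simp
  | add f f' _ _ hf hf' =>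
    rw [add_mul]
    exact add_mem hf hf'

end GradedAlgebra

section LevelOneForms

/-- The level one modular forms of weight `k`, as a space of functions on the upper half plane, so
that forms of different weights can be multiplied and compared. -/
def levelOneForms (k : ℤ) : Submodule ℂ (ℍ → ℂ) where
  carrier := {f | ∃ F : ModularForm 𝒮ℒ k, (F : ℍ → ℂ) = f}
  add_mem' := by
    rintro _ _ ⟨F, rfl⟩ ⟨G, rfl⟩
    exact ⟨F + G, rfl⟩
  zero_mem' := ⟨0, rfl⟩
  smul_mem' := by
    rintro c _ ⟨F, rfl⟩
    exact ⟨c • F, rfl⟩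

instance : SetLike.GradedMonoid levelOneForms where
  one_mem := ⟨1, rfl⟩
  mul_mem := by
    rintro k l _ _ ⟨F, rfl⟩ ⟨G, rfl⟩
    exact ⟨F.mul G, rfl⟩

variable {k l : ℤ} {f g : ℍ → ℂ}

theorem coe_mem_levelOneForms (F : ModularForm 𝒮ℒ k) : (F : ℍ → ℂ) ∈ levelOneForms k := ⟨F, rfl⟩

theorem mdiff_of_mem_levelOneForms (hf : f ∈ levelOneForms k) : MDiff f := by
  obtain ⟨F, rfl⟩ := hf
  exact F.holo'

theorem slash_eq_of_mem_levelOneForms (hf : f ∈ levelOneForms k) (γ : SL(2, ℤ)) :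
    f ∣[k] γ = f := by
  obtain ⟨F, rfl⟩ := hf
  exact F.slash_action_eq' _ ⟨γ, rfl⟩

theorem isBoundedAtImInfty_of_mem_levelOneForms (hf : f ∈ levelOneForms k) :
    IsBoundedAtImInfty f := by
  obtain ⟨F, rfl⟩ := hf
  exact ModularFormClass.bdd_at_infty F

theorem mem_levelOneForms (hf : MDiff f) (hslash : ∀ γ : SL(2, ℤ), f ∣[k] γ = f)
    (hbdd : IsBoundedAtImInfty f) : f ∈ levelOneForms k :=
  ⟨{ toFun := f
     slash_action_eq' := fun _ ⟨γ, hγ⟩ ↦ hγ ▸ hslash γ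
     holo' := hf
     bdd_at_cusps' := fun {c} hc ↦ by
      rw [Subgroup.IsArithmetic.isCusp_iff_isCusp_SL2Z] at hc
      rw [OnePoint.isBoundedAt_iff_forall_SL2Z hc]
      intro γ _
      rwa [hslash γ] }, rfl⟩

theorem isBoundedAtImInfty_normalizedDerivOfComplex (hf : MDiff f) (hbdd : IsBoundedAtImInfty f) :
    IsBoundedAtImInfty (D f) := by
  obtain ⟨C, A, hC⟩ := isBoundedAtImInfty_iff.mp hbdd
  -- Cauchy's estimate on the circle of radius one around a point high enough in `ℍ`
  refine isBoundedAtImInfty_iff.mpr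
    ⟨‖(2 * Real.pi * Complex.I : ℂ)⁻¹‖ * (C / 1), max A 0 + 2, fun z hz ↦ ?_⟩
  have him (w : ℂ) (hw : w ∈ Metric.closedBall (z : ℂ) 1) : max A 0 < w.im := by
    have hdist : |(w - z).im| ≤ 1 :=
      (Complex.abs_im_le_norm _).trans (mem_closedBall_iff_norm.mp hw)
    have := (abs_le.mp hdist).1
    simp only [Complex.sub_im, UpperHalfPlane.coe_im] at this
    linarith
  have hpos (w : ℂ) (hw : w ∈ Metric.closedBall (z : ℂ) 1) : 0 < w.im :=
    (le_max_right _ _).trans_lt (him w hw)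
  rw [normalizedDerivOfComplex, norm_mul]
  gcongr
  refine Complex.norm_deriv_le_of_forall_mem_sphere_norm_le one_pos
    (DifferentiableOn.diffContOnCl_ball (UpperHalfPlane.mdifferentiable_iff.mp hf) hpos) ?_
  intro w hw
  replace hw := Metric.sphere_subset_closedBall hw
  rw [Function.comp_apply, ofComplex_apply_of_im_pos (hpos w hw)]
  exact hC _ ((le_max_left _ _).trans (him w hw).le)

theorem isBoundedAtImInfty_serreDerivative (m : ℂ) (hf : MDiff f) (hbdd : IsBoundedAtImInfty f) :
    IsBoundedAtImInfty (serreDerivative m f) := by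
  have h : serreDerivative m f = D f - (m * 12⁻¹) • (E2 * f) := by
    ext z
    simp only [serreDerivative_apply, Pi.sub_apply, Pi.smul_apply, Pi.mul_apply, smul_eq_mul,
      mul_assoc]
  rw [h]
  exact (isBoundedAtImInfty_normalizedDerivOfComplex hf hbdd).sub
    ((isBoundedAtImInfty_E2.mul hbdd).const_smul_left _)

theorem serreDerivative_mem_levelOneForms (hf : f ∈ levelOneForms k) :
    serreDerivative k f ∈ levelOneForms (k + 2) :=
  have hmdiff := mdiff_of_mem_levelOneForms hf
  mem_levelOneForms (serreDerivative_mdifferentiable _ hmdiff)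
    (fun γ ↦ serreDerivative_slash_invariant hmdiff (slash_eq_of_mem_levelOneForms hf γ))
    (isBoundedAtImInfty_serreDerivative _ hmdiff (isBoundedAtImInfty_of_mem_levelOneForms hf))

theorem serreDerivative_zero (m : ℂ) : serreDerivative m (0 : ℍ → ℂ) = 0 := by
  simpa only [zero_smul] using
    serreDerivative_smul m 0 (0 : ℍ → ℂ) mdifferentiable_const

theorem mdiff_iterSerre (m : ℝ) (n : ℕ) (hf : MDiff f) : MDiff (iterSerre m n f) := by
  induction n with
  | zero => exact hf
  | succ n ih => exact serreDerivative_mdifferentiable _ ih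

end LevelOneForms

section EisensteinGenerators

open MvPolynomial

/-- The weights of `E₄` and `E₆`, in this order. -/
def eisensteinWeight : Fin 2 → ℤ := ![4, 6]

/-- The substitution of `E₄` and `E₆` into a polynomial in two variables, which presents the graded
ring of level one modular forms. -/
def evalE₄E₆ : MvPolynomial (Fin 2) ℂ →ₐ[ℂ] (ℍ → ℂ) :=
  aeval ![(E₄ : ℍ → ℂ), (E₆ : ℍ → ℂ)]

variable {k : ℤ} {f g : ℍ → ℂ} {p : MvPolynomial (Fin 2) ℂ}

theorem weight_eisensteinWeight (d : Fin 2 →₀ ℕ) :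
    Finsupp.weight eisensteinWeight d = d 0 * 4 + d 1 * 6 := by
  simp [Finsupp.weight_apply, Finsupp.sum_fintype, eisensteinWeight]

theorem evalE₄E₆_apply (p : MvPolynomial (Fin 2) ℂ) (z : ℍ) :
    evalE₄E₆ p z = eval ![E₄ z, E₆ z] p := by
  have h : (Pi.evalAlgHom ℂ (fun _ : ℍ ↦ ℂ) z).comp evalE₄E₆ = aeval ![E₄ z, E₆ z] := by
    ext i
    fin_cases i <;> simp [evalE₄E₆]
  exact DFunLike.congr_fun h p

theorem evalE₄E₆_X_zero : evalE₄E₆ (X 0) = E₄ := by simp [evalE₄E₆]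

theorem evalE₄E₆_X_one : evalE₄E₆ (X 1) = E₆ := by simp [evalE₄E₆]

theorem E₄_pow_mul_E₆_pow_mem_levelOneForms {a b : ℕ} (h : (a : ℤ) * 4 + b * 6 = k) :
    (E₄ : ℍ → ℂ) ^ a * (E₆ : ℍ → ℂ) ^ b ∈ levelOneForms k := by
  rw [← h]
  simpa only [nsmul_eq_mul] using SetLike.mul_mem_graded
    (SetLike.pow_mem_graded a (coe_mem_levelOneForms E₄))
    (SetLike.pow_mem_graded b (coe_mem_levelOneForms E₆))

theorem evalE₄E₆_mem_levelOneForms (hp : p.IsWeightedHomogeneous eisensteinWeight k) :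
    evalE₄E₆ p ∈ levelOneForms k := by
  induction hp using IsWeightedHomogeneous.induction_on with
  | zero => simp
  | add p q _ _ hp hq =>
    rw [map_add]
    exact add_mem hp hq
  | monomial d r hd =>
    rw [monomial_eq, map_mul, ← algebraMap_eq, AlgHom.commutes, ← Algebra.smul_def,
      Finsupp.prod_fintype _ _ fun _ ↦ pow_zero _, Fin.prod_univ_two, map_mul, map_pow, map_pow,
      evalE₄E₆_X_zero, evalE₄E₆_X_one]
    exact Submodule.smul_mem _ _
      (E₄_pow_mul_E₆_pow_mem_levelOneForms ((weight_eisensteinWeight d).symm.trans hd))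

theorem qExpansion_coeff_zero_E₄_pow_mul_E₆_pow (a b : ℕ) :
    (qExpansion 1 ((E₄ : ℍ → ℂ) ^ a * (E₆ : ℍ → ℂ) ^ b)).coeff 0 = 1 := by
  have h₄ := E_qExpansion_coeff_zero (k := 4) (by norm_num) ⟨2, rfl⟩
  have h₆ := E_qExpansion_coeff_zero (k := 6) (by norm_num) ⟨3, rfl⟩
  rw [PowerSeries.coeff_zero_eq_constantCoeff] at *
  rw [← ModularForm.coe_pow, ← ModularForm.coe_pow,
    ModularForm.qExpansion_mul_coe one_pos one_mem_strictPeriods_SL,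
    ModularForm.qExpansion_pow one_pos one_mem_strictPeriods_SL,
    ModularForm.qExpansion_pow one_pos one_mem_strictPeriods_SL, map_mul, map_pow, map_pow,
    h₄, h₆, one_pow, one_pow, one_mul]

theorem exists_eq_discriminant_mul (F : ModularForm 𝒮ℒ k) (h : (qExpansion 1 F).coeff 0 = 0) :
    ∃ g ∈ levelOneForms (k - 12), (F : ℍ → ℂ) = discriminant * g :=
  ⟨_, coe_mem_levelOneForms (CuspForm.discriminantEquiv (toCuspForm F h)),
    (discriminant_mul_discriminantEquiv (toCuspForm F h)).symm⟩

theorem exists_eq_smul_add_discriminant_mul (hf : f ∈ levelOneForms k) (hg : g ∈ levelOneForms k)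
    (h : (qExpansion 1 g).coeff 0 = 1) :
    ∃ c : ℂ, ∃ g' ∈ levelOneForms (k - 12), f = c • g + discriminant * g' := by
  obtain ⟨F, rfl⟩ := hf
  obtain ⟨G, rfl⟩ := hg
  obtain ⟨g', hg', hdiff⟩ := exists_eq_discriminant_mul (F - (qExpansion 1 F).coeff 0 • G) (by
    rw [FunLike.coe_sub, ModularForm.qExpansion_sub one_pos one_mem_strictPeriods_SL,
      FunLike.coe_smul, ModularForm.qExpansion_smul one_pos one_mem_strictPeriods_SL, map_sub,
      PowerSeries.coeff_smul, h, smul_eq_mul, mul_one, sub_self])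
  refine ⟨(qExpansion 1 F).coeff 0, g', hg', ?_⟩
  rw [← hdiff, FunLike.coe_sub, FunLike.coe_smul, add_sub_cancel]

theorem levelOneForms_eq_bot_or_exists_weight_eq (k : ℤ) :
    levelOneForms k = ⊥ ∨ ∃ a b : ℕ, (a : ℤ) * 4 + b * 6 = k := by
  have eq_bot (h : ∀ F : ModularForm 𝒮ℒ k, F = 0) : levelOneForms k = ⊥ :=
    (Submodule.eq_bot_iff _).mpr fun _ ⟨F, hF⟩ ↦ by rw [← hF, h F, FunLike.coe_zero]
  rcases lt_or_ge k 0 with hneg | hnonneg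
  · exact .inl (eq_bot fun F ↦
      DFunLike.coe_injective (ModularFormClass.levelOne_neg_weight_eq_zero hneg F))
  obtain ⟨m, rfl⟩ | hodd := Int.even_or_odd k
  swap
  · exact .inl (eq_bot (levelOne_odd_weight_eq_zero hodd))
  by_cases htwo : m = 1
  · subst htwo
    exact .inl (eq_bot (rank_zero_iff_forall_zero.mp levelOne_weight_two_rank_zero))
  · obtain ⟨j, rfl⟩ | ⟨j, rfl⟩ := Int.even_or_odd m
    · exact .inr ⟨j.toNat, 0, by lia⟩
    · exact .inr ⟨(j - 1).toNat, 1, by lia⟩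

theorem exists_evalE₄E₆_eq_discriminant :
    ∃ p : MvPolynomial (Fin 2) ℂ, p.IsWeightedHomogeneous eisensteinWeight 12 ∧
      evalE₄E₆ p = discriminant := by
  refine ⟨C (1728⁻¹ : ℂ) * (X 0 ^ 3 - X 1 ^ 2), .C_mul (.sub ?_ ?_) _, ?_⟩
  · exact (isWeightedHomogeneous_X ℂ eisensteinWeight 0).pow 3
  · exact (isWeightedHomogeneous_X ℂ eisensteinWeight 1).pow 2
  · ext z
    rw [discriminant_eq_E₄_cube_sub_E₆_sq, evalE₄E₆_apply]
    simp [div_eq_inv_mul]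

theorem exists_evalE₄E₆_eq (k : ℤ) {f : ℍ → ℂ} (hf : f ∈ levelOneForms k) :
    ∃ p : MvPolynomial (Fin 2) ℂ, p.IsWeightedHomogeneous eisensteinWeight k ∧
      evalE₄E₆ p = f := by
  obtain hbot | ⟨a, b, hab⟩ := levelOneForms_eq_bot_or_exists_weight_eq k
  · rw [hbot, Submodule.mem_bot] at hf
    exact ⟨0, isWeightedHomogeneous_zero _ _ _, by rw [map_zero, hf]⟩
  obtain ⟨c, g, hg, rfl⟩ := exists_eq_smul_add_discriminant_mul hf
    (E₄_pow_mul_E₆_pow_mem_levelOneForms hab) (qExpansion_coeff_zero_E₄_pow_mul_E₆_pow a b)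
  obtain ⟨p, hp, rfl⟩ := exists_evalE₄E₆_eq (k - 12) hg
  obtain ⟨q, hq, hqΔ⟩ := exists_evalE₄E₆_eq_discriminant
  refine ⟨C c * (X 0 ^ a * X 1 ^ b) + q * p, .add (.C_mul ?_ _) ?_, ?_⟩
  · rw [← hab]
    simpa [eisensteinWeight] using ((isWeightedHomogeneous_X ℂ eisensteinWeight 0).pow a).mul
      ((isWeightedHomogeneous_X ℂ eisensteinWeight 1).pow b)
  · simpa only [add_sub_cancel] using hq.mul hp
  · rw [map_add, map_mul, map_mul, map_mul, map_pow, map_pow, evalE₄E₆_X_zero, evalE₄E₆_X_one,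
      hqΔ, ← algebraMap_eq, AlgHom.commutes, Algebra.smul_def]
termination_by (k + 1).toNat

theorem E₆_I : E₆ UpperHalfPlane.I = 0 := by
  have hS : ModularGroup.S • UpperHalfPlane.I = UpperHalfPlane.I := by
    rw [UpperHalfPlane.modular_S_smul]
    ext
    simp
  have hI : (UpperHalfPlane.I : ℂ) ^ (-6 : ℤ) = -1 := by
    rw [UpperHalfPlane.coe_I, zpow_neg, show (6 : ℤ) = (2 * 3 : ℕ) from rfl, zpow_natCast,
      pow_mul, Complex.I_sq]
    norm_num
  have h := congrFun
    (slash_eq_of_mem_levelOneForms (coe_mem_levelOneForms E₆) ModularGroup.S) UpperHalfPlane.I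
  rw [ModularForm.SL_slash_apply, hS, ModularGroup.denom_S, hI] at h
  linear_combination -(1 / 2 : ℂ) * h

theorem E₄_I_ne_zero : E₄ UpperHalfPlane.I ≠ 0 := fun h ↦
  discriminant_ne_zero UpperHalfPlane.I <| by
    rw [discriminant_eq_E₄_cube_sub_E₆_sq, h, E₆_I]
    norm_num

theorem X_one_dvd_of_evalE₄E₆_I_eq_zero (hp : p.IsWeightedHomogeneous eisensteinWeight k)
    (h : evalE₄E₆ p UpperHalfPlane.I = 0) : X 1 ∣ p := by
  have hcoeff (d : Fin 2 →₀ ℕ) (hd : d 1 = 0) : p.coeff d = 0 := by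
    by_contra hne
    -- `E₆` vanishes at `i`, so only the pure power of `E₄` of weight `k` contributes there.
    have hvanish (e : Fin 2 →₀ ℕ) (he : e ∈ p.support) (hed : e ≠ d) : e 1 ≠ 0 := by
      intro he₁
      have hwe := hp (mem_support_iff.mp he)
      have hwd := hp hne
      rw [weight_eisensteinWeight] at hwe hwd
      refine hed (Finsupp.ext (Fin.forall_fin_two.mpr ⟨by lia, he₁.trans hd.symm⟩))
    rw [evalE₄E₆_apply, eval_eq', Finset.sum_eq_single d
      (fun e he hed ↦ by simp [Fin.prod_univ_two, E₆_I, hvanish e he hed])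
      (fun hd' ↦ by simp [notMem_support_iff.mp hd'])] at h
    simp [Fin.prod_univ_two, hd, E₄_I_ne_zero, hne] at h
  rw [X_dvd_iff_modMonomial_eq_zero]
  ext d
  by_cases hd : Finsupp.single 1 1 ≤ d
  · rw [coeff_modMonomial_of_le _ hd, coeff_zero]
  · rw [coeff_modMonomial_of_not_le _ hd, coeff_zero, hcoeff d]
    rwa [Finsupp.single_le_iff, Nat.one_le_iff_ne_zero, not_not] at hd

theorem eq_zero_of_evalE₄E₆_eq_zero (k : ℤ) {p : MvPolynomial (Fin 2) ℂ}
    (hp : p.IsWeightedHomogeneous eisensteinWeight k) (h : evalE₄E₆ p = 0) : p = 0 := by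
  by_contra hne
  have : 0 ≤ k := by
    obtain ⟨d, hd⟩ := exists_coeff_ne_zero hne
    rw [← hp hd, weight_eisensteinWeight]
    lia
  obtain ⟨q, rfl⟩ := X_one_dvd_of_evalE₄E₆_I_eq_zero hp (congrFun h UpperHalfPlane.I)
  have hq : q.IsWeightedHomogeneous eisensteinWeight (k - 6) := by
    intro d hd
    have := hp (d := Finsupp.single 1 1 + d) (by rwa [coeff_X_mul])
    simpa [eq_sub_iff_add_eq', eisensteinWeight, Finsupp.weight_single] using this
  have hE₆ : (E₆ : ℍ → ℂ) ≠ 0 := fun hE₆ ↦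
    E_ne_zero (k := 6) (by norm_num) ⟨3, rfl⟩ (DFunLike.coe_injective hE₆)
  rw [map_mul, evalE₄E₆_X_one] at h
  have hq_eval : evalE₄E₆ q = 0 := ((UpperHalfPlane.mul_eq_zero_iff E₆.holo'
    (mdiff_of_mem_levelOneForms (evalE₄E₆_mem_levelOneForms hq))).mp h).resolve_left hE₆
  exact hne (by rw [eq_zero_of_evalE₄E₆_eq_zero (k - 6) hq hq_eval, mul_zero])
termination_by (k + 1).toNat

end EisensteinGenerators

section EisensteinE2

/-- The weight two cocycle measuring the failure of modularity of `E₂`: it is `1 / 12` of the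
difference between `E₂ ∣[2] γ` and `E₂`. -/
def E2Cocycle (γ : SL(2, ℤ)) (z : ℍ) : ℂ :=
  (2 * Real.pi * Complex.I)⁻¹ * (γ 1 0 / denom γ z)

theorem E2_slash_eq_add_E2Cocycle (γ : SL(2, ℤ)) :
    E2 ∣[(2 : ℤ)] γ = E2 + (12 : ℂ) • E2Cocycle γ := by
  ext z
  have hI := Complex.I_sq
  have hpi : (Real.pi : ℂ) ≠ 0 := Complex.ofReal_ne_zero.mpr Real.pi_ne_zero
  have hdenom := denom_ne_zero (γ : GL (Fin 2) ℝ) z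
  simp only [E2_slash_action, E2Cocycle, Pi.add_apply, Pi.sub_apply, Pi.smul_apply, smul_eq_mul,
    D2, riemannZeta_two]
  field_simp
  linear_combination (-12 * (γ 1 0 : ℂ)) * hI

theorem mdiff_E2Cocycle (γ : SL(2, ℤ)) : MDiff (E2Cocycle γ) := by
  have h : E2Cocycle γ = fun z : ℍ ↦ (2 * Real.pi * Complex.I)⁻¹ * (γ 1 0 * (denom γ z)⁻¹) := rfl
  rw [h]
  exact mdifferentiable_const.mul (mdifferentiable_const.mul (mdifferentiable_inv_denom _))

theorem normalizedDerivOfComplex_E2Cocycle (γ : SL(2, ℤ)) :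
    D (E2Cocycle γ) = -E2Cocycle γ ^ 2 := by
  ext z
  have hderiv : HasDerivAt (E2Cocycle γ ∘ ofComplex) ((2 * Real.pi * Complex.I)⁻¹ *
      ((γ 1 0 : ℂ) * (-1 * (γ 1 0 : ℂ) * denom γ z ^ (-1 - 1 : ℤ)))) z := by
    have h := ((hasDerivAt_denom_zpow (γ : GL (Fin 2) ℝ) (-1) z).const_mul (γ 1 0 : ℂ)).const_mul
      (2 * Real.pi * Complex.I : ℂ)⁻¹
    refine HasDerivAt.congr_of_eventuallyEq (by simpa using h) ?_
    filter_upwards [isOpen_upperHalfPlaneSet.mem_nhds z.im_pos] with w hw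
    simp [E2Cocycle, ofComplex_apply_of_im_pos hw, div_eq_mul_inv]
  have hdenom := denom_ne_zero (γ : GL (Fin 2) ℝ) z
  rw [normalizedDerivOfComplex, hderiv.deriv, show (-1 - 1 : ℤ) = -(2 : ℕ) from rfl, zpow_neg,
    zpow_natCast]
  simp only [E2Cocycle, Pi.neg_apply, Pi.pow_apply]
  field_simp

theorem serreDerivative_one_E2_mem_levelOneForms : serreDerivative 1 E2 ∈ levelOneForms 4 := by
  refine mem_levelOneForms (serreDerivative_mdifferentiable _ E2_mdifferentiable) (fun γ ↦ ?_)
    (isBoundedAtImInfty_serreDerivative _ E2_mdifferentiable isBoundedAtImInfty_E2)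
  have hϑ : serreDerivative 1 E2 = serreDerivative 2 E2 + (12⁻¹ : ℂ) • (E2 * E2) := by
    ext z
    simp only [serreDerivative_apply, Pi.add_apply, Pi.smul_apply, Pi.mul_apply, smul_eq_mul]
    ring
  have hequivariant : serreDerivative 2 E2 ∣[(4 : ℤ)] γ =
      serreDerivative 2 (E2 + (12 : ℂ) • E2Cocycle γ) := by
    rw [← E2_slash_eq_add_E2Cocycle]
    exact_mod_cast serreDerivative_slash_equivariant (k := 2) (γ := γ) E2_mdifferentiable
  have hsq : (E2 * E2) ∣[(4 : ℤ)] γ =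
      (E2 + (12 : ℂ) • E2Cocycle γ) * (E2 + (12 : ℂ) • E2Cocycle γ) := by
    rw [← E2_slash_eq_add_E2Cocycle]
    exact ModularForm.mul_slash_SL2 2 2 γ E2 E2
  rw [hϑ, SlashAction.add_slash, ModularForm.SL_smul_slash, hequivariant, hsq,
    serreDerivative_add _ _ _ E2_mdifferentiable ((mdiff_E2Cocycle γ).const_smul _),
    serreDerivative_smul _ _ _ (mdiff_E2Cocycle γ)]
  ext z
  simp only [serreDerivative_apply, normalizedDerivOfComplex_E2Cocycle, Pi.add_apply,
    Pi.smul_apply, Pi.mul_apply, Pi.neg_apply, Pi.pow_apply, smul_eq_mul]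
  ring

theorem infinite_range_E2_slash (z : ℍ) :
    (Set.range fun γ : SL(2, ℤ) ↦ (E2 ∣[(2 : ℤ)] γ) z).Infinite := by
  let γ (n : ℤ) : SL(2, ℤ) := ⟨!![1, 0; n, 1], by simp⟩
  refine Set.infinite_of_injective_forall_mem (f := fun n ↦ (E2 ∣[(2 : ℤ)] γ n) z) ?_
    fun n ↦ ⟨γ n, rfl⟩
  intro m n hmn
  have hm := denom_ne_zero (γ m : GL (Fin 2) ℝ) z
  have hn := denom_ne_zero (γ n : GL (Fin 2) ℝ) z
  simp only [E2_slash_eq_add_E2Cocycle, Pi.add_apply, Pi.smul_apply, smul_eq_mul, E2Cocycle,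
    add_right_inj, mul_eq_mul_left_iff, inv_eq_zero, Complex.two_pi_I_ne_zero, or_false,
    OfNat.ofNat_ne_zero] at hmn
  rw [div_eq_div_iff hm hn, ModularGroup.denom_apply, ModularGroup.denom_apply] at hmn
  simp only [γ, Matrix.of_apply, Matrix.cons_val_one,
    Matrix.cons_val_zero, Int.cast_one, Matrix.cons_val_fin_one] at hmn
  exact_mod_cast (by linear_combination hmn : (m : ℂ) = n)

variable {N : ℕ} {k : ℤ}

theorem mul_E2_slash_pow {n : ℕ} {a : ℍ → ℂ} (ha : a ∈ levelOneForms (k - 2 * n))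
    (γ : SL(2, ℤ)) : a * (E2 ∣[(2 : ℤ)] γ) ^ n = (a * E2 ^ n) ∣[k] γ := by
  ext z
  have hz := denom_ne_zero (γ : GL (Fin 2) ℝ) z
  nth_rw 1 [← slash_eq_of_mem_levelOneForms ha γ]
  simp only [Pi.mul_apply, Pi.pow_apply, ModularForm.SL_slash_apply]
  rw [mul_pow, ← zpow_natCast (denom γ z ^ (-2 : ℤ)), ← zpow_mul,
    show -k = -(k - 2 * n) + -2 * n by ring, zpow_add₀ hz]
  ring

theorem eq_zero_of_sum_mul_E2_pow_eq_zero {a : Fin N → ℍ → ℂ}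
    (ha : ∀ i : Fin N, a i ∈ levelOneForms (k - 2 * (i : ℕ))) (h : ∑ i, a i * E2 ^ (i : ℕ) = 0)
    (i : Fin N) : a i = 0 := by
  ext z
  -- By invariance of the coefficients, this polynomial vanishes at all values `(E₂ ∣[2] γ) z`.
  let P : Polynomial ℂ := ∑ i : Fin N, Polynomial.C (a i z) * Polynomial.X ^ (i : ℕ)
  have hroot (γ : SL(2, ℤ)) : P.IsRoot ((E2 ∣[(2 : ℤ)] γ) z) := by
    have hslash : ∑ i : Fin N, a i * (E2 ∣[(2 : ℤ)] γ) ^ (i : ℕ) = 0 := by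
      rw [Finset.sum_congr rfl fun i _ ↦ mul_E2_slash_pow (ha i) γ, ← SlashAction.sum_slash, h,
        SlashAction.zero_slash]
    simpa [P, Polynomial.IsRoot, Polynomial.eval_finsetSum] using congrFun hslash z
  have hP : P = 0 := Polynomial.eq_zero_of_infinite_isRoot P
    ((infinite_range_E2_slash z).mono (Set.range_subset_iff.mpr hroot))
  simpa [P, Polynomial.finsetSum_coeff, Polynomial.coeff_X_pow, Fin.val_inj] using
    congrArg (Polynomial.coeff · i) hP

end EisensteinE2

section SerreStable

variable {ι κ : Type*} [Fintype ι] [Fintype κ] {u : ι → ℍ → ℂ} {v : κ → ℍ → ℂ} {w : ι → ℤ}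
  {x : κ → ℤ} {k : ℤ} {r s : ℂ} {f g : ℍ → ℂ}

theorem exists_levelOneForms_recurrence {d : ℕ → ℤ} {f : ℕ → ℍ → ℂ}
    (hf : ∀ n, f n ∈ gradedSpan levelOneForms u w (d n)) :
    ∃ n, ∃ a : ℕ → ℍ → ℂ, (∀ j, a j ∈ levelOneForms (d n - d j)) ∧
      f n = ∑ j ∈ Finset.range n, a j * f j := by
  let := MvPolynomial.weightedGradedAlgebra ℂ eisensteinWeight
  choose c hc hcf using hf
  choose p hp hpc using fun n i ↦ exists_evalE₄E₆_eq _ (hc n i)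
  obtain ⟨n, q, hq, hqp⟩ := exists_homogeneous_recurrence
    (MvPolynomial.weightedHomogeneousSubmodule ℂ eisensteinWeight) hp
  refine ⟨n, fun j ↦ evalE₄E₆ (q j), fun j ↦ evalE₄E₆_mem_levelOneForms (hq j), ?_⟩
  calc f n = ∑ i, (∑ j ∈ Finset.range n, evalE₄E₆ (q j) * c j i) * u i := by
        simp only [← hcf n, ← hpc, hqp, map_sum, map_mul]
    _ = ∑ j ∈ Finset.range n, evalE₄E₆ (q j) * f j := by
        simp only [← hcf, Finset.sum_mul, Finset.mul_sum, mul_assoc]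
        exact Finset.sum_comm

theorem mdiff_of_mem_gradedSpan (hu : ∀ i, MDiff (u i))
    (hf : f ∈ gradedSpan levelOneForms u w k) : MDiff f := by
  induction hf using gradedSpan_induction with
  | mul i c hc => exact (mdiff_of_mem_levelOneForms hc).mul (hu i)
  | zero => exact mdifferentiable_const
  | add f g _ _ hf hg => exact MDifferentiable.add hf hg

theorem serreDerivative_mem_gradedSpan (hu : ∀ i, MDiff (u i))
    (hmem : ∀ i, u i ∈ gradedSpan levelOneForms v x (w i))
    (hderiv : ∀ i, serreDerivative (r + w i) (u i) ∈ gradedSpan levelOneForms v x (w i + 2))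
    (hf : f ∈ gradedSpan levelOneForms u w k) :
    serreDerivative (r + k) f ∈ gradedSpan levelOneForms v x (k + 2) := by
  induction hf using gradedSpan_induction with
  | mul i c hc =>
    have hmul := serreDerivative_mul (k - w i : ℤ) (r + w i) c (u i)
      (mdiff_of_mem_levelOneForms hc) (hu i)
    rw [show ((k - w i : ℤ) : ℂ) + (r + w i) = r + k by push_cast; ring] at hmul
    rw [hmul]
    exact add_mem
      (mul_mem_gradedSpan (serreDerivative_mem_levelOneForms hc) (hmem i) (by ring))
      (mul_mem_gradedSpan hc (hderiv i) (by ring))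
  | zero =>
    rw [serreDerivative_zero]
    exact zero_mem _
  | add f g hf hg hf' hg' =>
    rw [serreDerivative_add _ _ _ (mdiff_of_mem_gradedSpan hu hf) (mdiff_of_mem_gradedSpan hu hg)]
    exact add_mem hf' hg'

/-- The graded module over the level one modular forms generated by the holomorphic functions `u i`
in degrees `w i` is stable under Serre derivatives, which act with weight `r + k` on its degree `k`
part. The shift `r` keeps the degrees integral while allowing arbitrary weights. -/
structure IsSerreStable (r : ℂ) (u : ι → ℍ → ℂ) (w : ι → ℤ) : Prop where
  mdiff : ∀ i, MDiff (u i)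
  serreDerivative_mem : ∀ i,
    serreDerivative (r + w i) (u i) ∈ gradedSpan levelOneForms u w (w i + 2)

namespace IsSerreStable

theorem serreDerivative_mem_gradedSpan (hu : IsSerreStable r u w)
    (hf : f ∈ gradedSpan levelOneForms u w k) :
    serreDerivative (r + k) f ∈ gradedSpan levelOneForms u w (k + 2) :=
  MLDE.serreDerivative_mem_gradedSpan hu.mdiff generator_mem_gradedSpan hu.serreDerivative_mem hf

theorem sumElim (hu : IsSerreStable r u w) (hv : IsSerreStable r v x) :
    IsSerreStable r (Sum.elim u v) (Sum.elim w x) where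
  mdiff := by
    rintro (i | i)
    exacts [hu.mdiff i, hv.mdiff i]
  serreDerivative_mem := by
    rintro (i | i)
    exacts [gradedSpan_comp_le (v := Sum.elim u v) (x := Sum.elim w x) Sum.inl
        (hu.serreDerivative_mem i),
      gradedSpan_comp_le (v := Sum.elim u v) (x := Sum.elim w x) Sum.inr
        (hv.serreDerivative_mem i)]

theorem mul (hu : IsSerreStable r u w) (hv : IsSerreStable s v x) :
    IsSerreStable (r + s) (fun i : ι × κ ↦ u i.1 * v i.2) (fun i ↦ w i.1 + x i.2) where
  mdiff i := (hu.mdiff i.1).mul (hv.mdiff i.2)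
  serreDerivative_mem i := by
    rw [show r + s + ((w i.1 + x i.2 : ℤ) : ℂ) = (r + w i.1) + (s + x i.2) by push_cast; ring,
      serreDerivative_mul _ _ _ _ (hu.mdiff i.1) (hv.mdiff i.2)]
    exact add_mem
      (mul_mem_gradedSpan_prod (hu.serreDerivative_mem i.1) (generator_mem_gradedSpan i.2)
        (by ring))
      (mul_mem_gradedSpan_prod (generator_mem_gradedSpan i.1) (hv.serreDerivative_mem i.2)
        (by ring))

end IsSerreStable

end SerreStable

section SigmaSet

variable {ι : Type*} [Fintype ι] {u : ι → ℍ → ℂ} {w : ι → ℤ} {k : ℤ} {m l : ℝ} {r : ℂ}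
  {f g : ℍ → ℂ}

theorem sum_Icc_one_eq_sum_range {M : Type*} [AddCommMonoid M] (n : ℕ) (F : ℕ → ℕ → M) :
    ∑ i ∈ Finset.Icc 1 n, F i (n - i) = ∑ j ∈ Finset.range n, F (n - j) j :=
  Finset.sum_nbij' (n - ·) (n - ·) (by grind) (by grind) (by grind) (by grind) (by grind)

theorem solvesMonicMLDE_iff {n : ℕ} :
    SolvesMonicMLDE m n f ↔
      ∃ a : ℕ → ℍ → ℂ, (∀ j < n, a j ∈ levelOneForms (2 * (n - j))) ∧
        iterSerre m n f = ∑ j ∈ Finset.range n, a j * iterSerre m j f := by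
  constructor
  · rintro ⟨g, hg⟩
    refine ⟨fun j ↦ -g (n - j), fun j hj ↦ ?_, ?_⟩
    · rw [← Nat.cast_sub hj.le]
      exact neg_mem (coe_mem_levelOneForms _)
    · ext z
      rw [eq_neg_of_add_eq_zero_left (hg z),
        sum_Icc_one_eq_sum_range n fun i j ↦ g i z * iterSerre m j f z]
      simp
  · rintro ⟨a, ha, hsum⟩
    have hmem (i : ℕ) : ∃ G : ModularForm 𝒮ℒ (2 * (i : ℤ)),
        (G : ℍ → ℂ) = if i ∈ Finset.Icc 1 n then -a (n - i) else 0 := by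
      split_ifs with hi
      · rw [Finset.mem_Icc] at hi
        have h := neg_mem (ha (n - i) (by lia))
        rwa [Nat.cast_sub hi.2, sub_sub_cancel] at h
      · exact ⟨0, rfl⟩
    choose G hG using hmem
    refine ⟨G, fun z ↦ ?_⟩
    rw [hsum, ← sum_Icc_one_eq_sum_range n fun _ j ↦ a j * iterSerre m j f, Finset.sum_apply,
      ← Finset.sum_add_distrib]
    refine Finset.sum_eq_zero fun i hi ↦ ?_
    rw [hG i, if_pos hi]
    simp

theorem IsSerreStable.mem_SigmaSet (hu : IsSerreStable r u w)
    (hf : f ∈ gradedSpan levelOneForms u w k) (hm : (m : ℂ) = r + k) : f ∈ SigmaSet m := by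
  have hiter (n : ℕ) : iterSerre m n f ∈ gradedSpan levelOneForms u w (k + 2 * n) := by
    induction n with
    | zero => simpa [iterSerre] using hf
    | succ n ih =>
      have h := hu.serreDerivative_mem_gradedSpan ih
      rw [show r + ((k + 2 * n : ℤ) : ℂ) = ((m + 2 * n : ℝ) : ℂ) by push_cast; rw [hm]; ring,
        show k + 2 * n + 2 = k + 2 * (n + 1 : ℕ) by push_cast; ring] at h
      exact h
  obtain ⟨n, a, ha, hsum⟩ := exists_levelOneForms_recurrence hiter
  refine ⟨mdiff_of_mem_gradedSpan hu.mdiff hf, n, solvesMonicMLDE_iff.mpr ⟨a, fun j _ ↦ ?_, hsum⟩⟩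
  rw [mul_sub, ← add_sub_add_left_eq_sub _ _ k]
  exact ha j

theorem exists_isSerreStable_of_mem_SigmaSet (hf : f ∈ SigmaSet m) :
    ∃ (n : ℕ) (u : Fin n → ℍ → ℂ) (w : Fin n → ℤ),
      IsSerreStable m u w ∧ f ∈ gradedSpan levelOneForms u w 0 := by
  obtain ⟨hmdiff, n, hn⟩ := hf
  obtain ⟨a, ha, hsum⟩ := solvesMonicMLDE_iff.mp hn
  let u (i : Fin n) : ℍ → ℂ := iterSerre m i f
  let w (i : Fin n) : ℤ := 2 * (i : ℕ)
  have hlt (j : ℕ) (hj : j < n) : iterSerre m j f ∈ gradedSpan levelOneForms u w (2 * j) :=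
    generator_mem_gradedSpan (u := u) (w := w) ⟨j, hj⟩
  have hle (j : ℕ) (hj : j ≤ n) : iterSerre m j f ∈ gradedSpan levelOneForms u w (2 * j) := by
    obtain hj | rfl := hj.lt_or_eq
    · exact hlt j hj
    · rw [hsum]
      refine sum_mem fun i hi ↦ ?_
      rw [Finset.mem_range] at hi
      exact mul_mem_gradedSpan (ha i hi) (hlt i hi) (by ring)
  refine ⟨n, u, w, ⟨fun i ↦ mdiff_iterSerre _ _ hmdiff, fun i ↦ ?_⟩, hle 0 n.zero_le⟩
  have h := hle (i + 1) i.isLt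
  rw [show 2 * ((i + 1 : ℕ) : ℤ) = w i + 2 by simp only [w]; push_cast; ring, iterSerre,
    show ((m + 2 * (i : ℕ) : ℝ) : ℂ) = m + w i by simp only [w]; push_cast; ring] at h
  exact h

theorem add_mem_SigmaSet (hf : f ∈ SigmaSet m) (hg : g ∈ SigmaSet m) : f + g ∈ SigmaSet m := by
  obtain ⟨_, u, w, hu, hfu⟩ := exists_isSerreStable_of_mem_SigmaSet hf
  obtain ⟨_, v, x, hv, hgv⟩ := exists_isSerreStable_of_mem_SigmaSet hg
  exact (hu.sumElim hv).mem_SigmaSet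
    (add_mem (gradedSpan_comp_le (v := Sum.elim u v) (x := Sum.elim w x) Sum.inl hfu)
      (gradedSpan_comp_le (v := Sum.elim u v) (x := Sum.elim w x) Sum.inr hgv)) (by simp)

theorem neg_mem_SigmaSet (hf : f ∈ SigmaSet m) : -f ∈ SigmaSet m := by
  obtain ⟨_, u, w, hu, hfu⟩ := exists_isSerreStable_of_mem_SigmaSet hf
  exact hu.mem_SigmaSet (neg_mem hfu) (by simp)

theorem mul_mem_SigmaSet (hf : f ∈ SigmaSet m) (hg : g ∈ SigmaSet l) :
    f * g ∈ SigmaSet (m + l) := by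
  obtain ⟨_, u, w, hu, hfu⟩ := exists_isSerreStable_of_mem_SigmaSet hf
  obtain ⟨_, v, x, hv, hgv⟩ := exists_isSerreStable_of_mem_SigmaSet hg
  exact (hu.mul hv).mem_SigmaSet (mul_mem_gradedSpan_prod hfu hgv (add_zero 0)) (by simp)

end SigmaSet

section Quasimodular

variable {N s : ℕ} {k l : ℤ} {m : ℝ} {f p : ℍ → ℂ}

theorem mdiff_E2_pow (i : ℕ) : MDiff (E2 ^ i) := by
  induction i with
  | zero => exact mdifferentiable_const
  | succ i ih =>
    rw [pow_succ]
    exact ih.mul E2_mdifferentiable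

theorem serreDerivative_E2_pow (r : ℂ) (i : ℕ) :
    serreDerivative r (E2 ^ i) =
      (i : ℂ) • (serreDerivative 1 E2 * E2 ^ (i - 1)) + ((i - r) * 12⁻¹) • E2 ^ (i + 1) := by
  ext z
  rcases i with _ | i
  · have h : D (1 : ℍ → ℂ) = 0 := normalizedDerivOfComplex_const 1
    simp [serreDerivative_apply, h]
  · rw [serreDerivative_apply, normalizedDerivOfComplex_pow _ _ E2_mdifferentiable]
    simp only [Nat.cast_add, Nat.cast_one, add_tsub_cancel_right, Pi.mul_apply, Pi.add_apply,
      Pi.natCast_apply, Pi.one_apply, Pi.pow_apply, serreDerivative_eq, one_mul, Pi.smul_apply,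
      smul_eq_mul]
    ring

/-- The quasimodular forms of weight `k` and depth less than `N`, that is, the polynomials in `E₂`
of degree less than `N` whose coefficients are level one modular forms. -/
def depthLT (N : ℕ) (k : ℤ) : Submodule ℂ (ℍ → ℂ) :=
  gradedSpan levelOneForms (fun i : Fin N ↦ E2 ^ (i : ℕ)) (fun i ↦ 2 * ((i : ℕ) : ℤ)) k

theorem mul_E2_pow_mem_depthLT {i : ℕ} (hi : i < N) (hp : p ∈ levelOneForms l)
    (h : l + 2 * i = k) : p * E2 ^ i ∈ depthLT N k :=
  mul_generator_mem_gradedSpan (u := fun i : Fin N ↦ E2 ^ (i : ℕ)) ⟨i, hi⟩ hp h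

theorem E2_pow_mem_depthLT {i : ℕ} (hi : i < N) : E2 ^ i ∈ depthLT N (2 * i) :=
  generator_mem_gradedSpan (u := fun i : Fin N ↦ E2 ^ (i : ℕ)) ⟨i, hi⟩

theorem depthLT_mono {M : ℕ} (h : M ≤ N) : depthLT M k ≤ depthLT N k :=
  gradedSpan_comp_le (v := fun i : Fin N ↦ E2 ^ (i : ℕ)) (x := fun i ↦ 2 * ((i : ℕ) : ℤ))
    (Fin.castLE h)

theorem serreDerivative_E2_pow_sub_mem_depthLT (r : ℂ) (i : ℕ) :
    serreDerivative r (E2 ^ i) - ((i - r) * 12⁻¹) • E2 ^ (i + 1) ∈ depthLT i (2 * i + 2) := by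
  rw [serreDerivative_E2_pow, add_sub_cancel_right]
  rcases i with _ | i
  · simp
  · exact Submodule.smul_mem _ _ (mul_E2_pow_mem_depthLT i.lt_succ_self
      serreDerivative_one_E2_mem_levelOneForms (by push_cast; ring))

theorem serreDerivative_E2_pow_mem_depthLT (r : ℂ) {i : ℕ} (hi : i + 1 < N) :
    serreDerivative r (E2 ^ i) ∈ depthLT N (2 * i + 2) := by
  rw [← sub_add_cancel (serreDerivative r (E2 ^ i)) (((i - r) * 12⁻¹) • E2 ^ (i + 1))]
  exact add_mem (depthLT_mono (by lia) (serreDerivative_E2_pow_sub_mem_depthLT r i))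
    (Submodule.smul_mem _ _ (E2_pow_mem_depthLT hi))

theorem isSerreStable_E2_pow (s : ℕ) :
    IsSerreStable (-s) (fun i : Fin (s + 1) ↦ E2 ^ (i : ℕ)) (fun i ↦ 2 * ((i : ℕ) : ℤ)) where
  mdiff i := mdiff_E2_pow i
  serreDerivative_mem i := by
    obtain hi | hi := (Nat.lt_succ_iff.mp i.isLt).lt_or_eq
    · exact serreDerivative_E2_pow_mem_depthLT _ (Nat.succ_lt_succ hi)
    · -- `E₂ ^ s` is differentiated in weight `s`, so the coefficient of `E₂ ^ (s + 1)` vanishes.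
      have hcoeff : ((i : ℕ) : ℂ) - (-s + (2 * ((i : ℕ) : ℤ) : ℤ)) = 0 := by
        push_cast [hi]
        ring
      have h := serreDerivative_E2_pow_sub_mem_depthLT (-s + (2 * ((i : ℕ) : ℤ) : ℤ)) i
      rw [hcoeff, zero_mul, zero_smul, sub_zero] at h
      exact depthLT_mono i.isLt.le h

theorem one_mem_SigmaSet_neg_natCast (n : ℕ) : (1 : ℍ → ℂ) ∈ SigmaSet (-n : ℝ) :=
  (isSerreStable_E2_pow n).mem_SigmaSet (E2_pow_mem_depthLT n.succ_pos) (by simp)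

theorem sub_natCast_mem_SigmaSet (hf : f ∈ SigmaSet m) (n : ℕ) : f ∈ SigmaSet (m - n) := by
  simpa only [mul_one, sub_eq_add_neg] using mul_mem_SigmaSet hf (one_mem_SigmaSet_neg_natCast n)

theorem mdiff_of_mem_depthLT (hf : f ∈ depthLT N k) : MDiff f :=
  mdiff_of_mem_gradedSpan (u := fun i : Fin N ↦ E2 ^ (i : ℕ)) (fun i ↦ mdiff_E2_pow i) hf

theorem serreDerivative_mem_depthLT (r : ℂ) (hf : f ∈ depthLT N k) :
    serreDerivative r f ∈ depthLT (N + 1) (k + 2) := by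
  rw [← sub_add_cancel r k]
  exact serreDerivative_mem_gradedSpan (u := fun i : Fin N ↦ E2 ^ (i : ℕ))
    (v := fun i : Fin (N + 1) ↦ E2 ^ (i : ℕ)) (fun i ↦ mdiff_E2_pow i)
    (fun i ↦ E2_pow_mem_depthLT (Nat.lt_succ_of_lt i.isLt))
    (fun i ↦ serreDerivative_E2_pow_mem_depthLT _ (Nat.succ_lt_succ i.isLt)) hf

/-- The function `f` is quasimodular of weight `k` and depth at most `s`, and `p` is its coefficient
at `E₂ ^ s`. The coefficient may vanish, so `s` is not necessarily the exact depth. -/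
structure HasLeadingCoeff (k : ℤ) (s : ℕ) (p f : ℍ → ℂ) : Prop where
  coeff_mem : p ∈ levelOneForms (k - 2 * s)
  sub_mul_mem : f - p * E2 ^ s ∈ depthLT s k

namespace HasLeadingCoeff

theorem mem_depthLT (h : HasLeadingCoeff k s p f) (hs : s < N) : f ∈ depthLT N k := by
  rw [← sub_add_cancel f (p * E2 ^ s)]
  exact add_mem (depthLT_mono hs.le h.sub_mul_mem)
    (mul_E2_pow_mem_depthLT hs h.coeff_mem (sub_add_cancel _ _))

theorem eq_zero_of_mem_depthLT (h : HasLeadingCoeff k s p f) (hf : f ∈ depthLT s k) : p = 0 := by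
  obtain ⟨c, hc, hsum⟩ : p * E2 ^ s ∈ depthLT s k := by
    simpa only [sub_sub_cancel] using sub_mem hf h.sub_mul_mem
  let a : Fin (s + 1) → ℍ → ℂ := Fin.snoc (-c) p
  have ha (i : Fin (s + 1)) : a i ∈ levelOneForms (k - 2 * (i : ℕ)) := by
    induction i using Fin.lastCases with
    | last => simpa [a] using h.coeff_mem
    | cast i => simpa [a] using hc i
  have hsum_eq_zero : ∑ i, a i * E2 ^ (i : ℕ) = 0 := by
    rw [Fin.sum_univ_castSucc]
    simp [a, hsum]
  simpa [a] using eq_zero_of_sum_mul_E2_pow_eq_zero ha hsum_eq_zero (Fin.last s)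

theorem serreDerivative (h : HasLeadingCoeff k s p f) (r : ℂ) :
    HasLeadingCoeff (k + 2) (s + 1) (((k - s - r) * 12⁻¹) • p)
      (Derivative.serreDerivative r f) where
  coeff_mem := by
    rw [show k + 2 - 2 * ((s + 1 : ℕ) : ℤ) = k - 2 * s by push_cast; ring]
    exact Submodule.smul_mem _ _ h.coeff_mem
  sub_mul_mem := by
    have hp := mdiff_of_mem_levelOneForms h.coeff_mem
    have hrest := mdiff_of_mem_depthLT h.sub_mul_mem
    have hadd := serreDerivative_add r _ _ hrest (hp.mul (mdiff_E2_pow s))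
    have hmul := serreDerivative_mul (k - 2 * s : ℤ) (r - (k - 2 * s : ℤ)) p (E2 ^ s) hp
      (mdiff_E2_pow s)
    rw [sub_add_cancel] at hadd
    rw [add_sub_cancel] at hmul
    have hE2 := mul_mem_gradedSpan h.coeff_mem
      (serreDerivative_E2_pow_sub_mem_depthLT (r - (k - 2 * s : ℤ)) s)
      (show _ = k + 2 by ring)
    have hcoeff := mul_E2_pow_mem_depthLT s.lt_succ_self
      (serreDerivative_mem_levelOneForms h.coeff_mem) (show _ = k + 2 by ring)
    convert add_mem (serreDerivative_mem_depthLT r h.sub_mul_mem)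
      (add_mem hcoeff (depthLT_mono s.le_succ hE2)) using 1
    rw [hadd, hmul]
    ext z
    simp only [Pi.add_apply, Pi.sub_apply, Pi.mul_apply, Pi.smul_apply, smul_eq_mul]
    push_cast
    ring

theorem exists_iterSerre (h : HasLeadingCoeff k s p f) (hm : ∀ n : ℕ, m ≠ k - s - n) (n : ℕ) :
    ∃ c : ℂ, c ≠ 0 ∧ HasLeadingCoeff (k + 2 * n) (s + n) (c • p) (iterSerre m n f) := by
  induction n with
  | zero => exact ⟨1, one_ne_zero, by simpa [iterSerre] using h⟩
  | succ n ih =>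
    obtain ⟨c, hc, hn⟩ := ih
    have hne : ((k + 2 * n : ℤ) - (s + n : ℕ) - (m + 2 * n : ℝ) : ℂ) ≠ 0 := by
      have := sub_ne_zero.mpr (hm n).symm
      rw [show ((k + 2 * n : ℤ) - (s + n : ℕ) - (m + 2 * n : ℝ) : ℂ) = (k - s - n - m : ℝ) by
        push_cast
        ring]
      exact Complex.ofReal_ne_zero.mpr this
    refine ⟨_, mul_ne_zero (mul_ne_zero hne (inv_ne_zero (by norm_num : (12 : ℂ) ≠ 0))) hc, ?_⟩
    have hsucc := hn.serreDerivative (m + 2 * n : ℝ)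
    rw [smul_smul, show k + 2 * n + 2 = k + 2 * (n + 1 : ℕ) by push_cast; ring] at hsucc
    exact hsucc

theorem exists_eq_sub_of_mem_SigmaSet (h : HasLeadingCoeff k s p f) (hp : p ≠ 0)
    (hf : f ∈ SigmaSet m) : ∃ n : ℕ, m = k - s - n := by
  by_contra! hm
  obtain ⟨-, n, hn⟩ := hf
  obtain ⟨a, ha, hsum⟩ := solvesMonicMLDE_iff.mp hn
  obtain ⟨c, hc, hlead⟩ := h.exists_iterSerre hm n
  refine smul_ne_zero hc hp (hlead.eq_zero_of_mem_depthLT ?_)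
  rw [hsum]
  refine sum_mem fun j hj ↦ ?_
  rw [Finset.mem_range] at hj
  obtain ⟨_, -, hj_lead⟩ := h.exists_iterSerre hm j
  exact mul_mem_gradedSpan (ha j hj) (hj_lead.mem_depthLT (Nat.add_lt_add_left hj s)) (by ring)

theorem mem_SigmaSet (h : HasLeadingCoeff k s p f) : f ∈ SigmaSet (k - s : ℝ) :=
  (isSerreStable_E2_pow s).mem_SigmaSet (h.mem_depthLT s.lt_succ_self) (by push_cast; ring)

end HasLeadingCoeff

theorem isWeightedHomogeneous_finSuccEquiv_coeff {k : ℕ} {P : MvPolynomial (Fin 3) ℂ}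
    (hP : P.IsWeightedHomogeneous (![2, 4, 6] : Fin 3 → ℕ) k) (i : ℕ) :
    ((MvPolynomial.finSuccEquiv ℂ 2 P).coeff i).IsWeightedHomogeneous eisensteinWeight
      ((k : ℤ) - 2 * i) := by
  intro d hd
  rw [MvPolynomial.finSuccEquiv_coeff_coeff] at hd
  have hweight := hP hd
  have hcons₁ : (Finsupp.cons i d : Fin 3 →₀ ℕ) 1 = d 0 := Finsupp.cons_succ 0 i d
  have hcons₂ : (Finsupp.cons i d : Fin 3 →₀ ℕ) 2 = d 1 := Finsupp.cons_succ 1 i d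
  simp only [Finsupp.weight_apply, smul_eq_mul, zero_mul, implies_true, Finsupp.sum_fintype,
    Fin.sum_univ_three, Finsupp.cons_zero, Matrix.cons_val_zero, hcons₁, Matrix.cons_val_one,
    hcons₂, Matrix.cons_val] at hweight
  rw [weight_eisensteinWeight]
  lia

theorem eval_E2_E₄_E₆_eq_sum (P : MvPolynomial (Fin 3) ℂ) (z : ℍ) :
    MvPolynomial.eval ![E2 z, E₄ z, E₆ z] P = ∑ i ∈ Finset.range (P.degreeOf 0 + 1),
      evalE₄E₆ ((MvPolynomial.finSuccEquiv ℂ 2 P).coeff i) z * E2 z ^ i := by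
  rw [show (![E2 z, E₄ z, E₆ z] : Fin 3 → ℂ) = Fin.cons (E2 z) ![E₄ z, E₆ z] from rfl,
    MvPolynomial.eval_eq_eval_mv_eval', Polynomial.eval_map, Polynomial.eval₂_eq_sum_range,
    MvPolynomial.natDegree_finSuccEquiv]
  simp only [evalE₄E₆_apply]

namespace IsQuasimodular

theorem exists_hasLeadingCoeff {k : ℕ} (h : IsQuasimodular k s f) (hf : f ≠ 0) :
    ∃ p ≠ 0, HasLeadingCoeff k s p f := by
  obtain ⟨P, hP, rfl, heval⟩ := h
  let Q := MvPolynomial.finSuccEquiv ℂ 2 P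
  have hhom := isWeightedHomogeneous_finSuccEquiv_coeff hP
  have hsum : f = ∑ i ∈ Finset.range (P.degreeOf 0 + 1), evalE₄E₆ (Q.coeff i) * E2 ^ i := by
    ext z
    simp [heval, eval_E2_E₄_E₆_eq_sum, Q]
  have hlead : Q.coeff (P.degreeOf 0) ≠ 0 := by
    rw [← MvPolynomial.natDegree_finSuccEquiv, Polynomial.coeff_natDegree,
      Polynomial.leadingCoeff_ne_zero]
    intro hQ
    exact hf (by simp [hsum, Q, hQ])
  refine ⟨evalE₄E₆ (Q.coeff (P.degreeOf 0)),
    fun h ↦ hlead (eq_zero_of_evalE₄E₆_eq_zero _ (hhom _) h),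
    evalE₄E₆_mem_levelOneForms (hhom _), ?_⟩
  rw [hsum, Finset.sum_range_succ, add_sub_cancel_right]
  exact sum_mem fun i hi ↦ mul_E2_pow_mem_depthLT (Finset.mem_range.mp hi)
    (evalE₄E₆_mem_levelOneForms (hhom i)) (sub_add_cancel _ _)

theorem mem_SigmaSet_iff {k : ℕ} (h : IsQuasimodular k s f) (hf : f ≠ 0) :
    f ∈ SigmaSet m ↔ ∃ n : ℕ, m = k - s - n := by
  obtain ⟨p, hp, hlead⟩ := h.exists_hasLeadingCoeff hf
  refine ⟨hlead.exists_eq_sub_of_mem_SigmaSet hp, ?_⟩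
  rintro ⟨n, rfl⟩
  exact sub_natCast_mem_SigmaSet hlead.mem_SigmaSet n

end IsQuasimodular

end Quasimodular

section DifferentialWeight

variable {f g : ℍ → ℂ} {x y : WithBot (WithTop ℤ)}

theorem antitone_intCast_mem_SigmaSet (f : ℍ → ℂ) : Antitone fun k : ℤ ↦ f ∈ SigmaSet k := by
  intro k l hkl (hf : f ∈ SigmaSet l)
  obtain ⟨n, rfl⟩ := Int.le.dest hkl
  simpa using sub_natCast_mem_SigmaSet hf n

theorem coe_le_dwt_iff {k : ℤ} :
    ((k : WithTop ℤ) : WithBot (WithTop ℤ)) ≤ dwt f ↔ f ∈ SigmaSet (k : ℝ) := by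
  refine ⟨fun h ↦ ?_, fun h ↦ le_sSup ⟨k, h, rfl⟩⟩
  by_contra hk
  have hle : dwt f ≤ (((k - 1 : ℤ) : WithTop ℤ) : WithBot (WithTop ℤ)) := by
    refine sSup_le ?_
    rintro _ ⟨m, hm, rfl⟩
    have hmk : m ≤ k - 1 :=
      Int.le_sub_one_of_lt <| not_le.mp fun hkm ↦ hk (antitone_intCast_mem_SigmaSet f hkm hm)
    exact_mod_cast hmk
  have : k ≤ k - 1 := by exact_mod_cast h.trans hle
  lia

theorem le_of_forall_coe_le (h : ∀ n : ℤ, ((n : WithTop ℤ) : WithBot (WithTop ℤ)) ≤ x →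
    ((n : WithTop ℤ) : WithBot (WithTop ℤ)) ≤ y) : x ≤ y := by
  induction x with
  | bot => exact bot_le
  | coe x =>
    induction x with
    | coe x => exact h x le_rfl
    | top =>
      have htop (n : ℤ) := h n (WithBot.coe_le_coe.mpr le_top)
      induction y with
      | bot => simpa using htop 0
      | coe y =>
        induction y with
        | top => exact le_rfl
        | coe y =>
          have : y + 1 ≤ y := by exact_mod_cast htop (y + 1)
          lia

theorem exists_coe_le_of_coe_le_add {n : ℤ}
    (h : ((n : WithTop ℤ) : WithBot (WithTop ℤ)) ≤ x + y) :
    ∃ a b : ℤ, ((a : WithTop ℤ) : WithBot (WithTop ℤ)) ≤ x ∧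
      ((b : WithTop ℤ) : WithBot (WithTop ℤ)) ≤ y ∧ n ≤ a + b := by
  have htop (a : ℤ) : ((a : WithTop ℤ) : WithBot (WithTop ℤ)) ≤ (⊤ : WithTop ℤ) :=
    WithBot.coe_le_coe.mpr le_top
  induction x with
  | bot => simp at h
  | coe x =>
    induction y with
    | bot => simp at h
    | coe y =>
      induction x with
      | top =>
        induction y with
        | top => exact ⟨n, 0, htop _, htop _, by lia⟩
        | coe y => exact ⟨n - y, y, htop _, le_rfl, by lia⟩
      | coe x =>
        induction y with
        | top => exact ⟨x, n - x, le_rfl, htop _, by lia⟩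
        | coe y => exact ⟨x, y, le_rfl, le_rfl, by exact_mod_cast h⟩

theorem dwt_add_dwt_le_dwt_mul (f g : ℍ → ℂ) : dwt f + dwt g ≤ dwt (f * g) := by
  refine le_of_forall_coe_le fun n hn ↦ ?_
  obtain ⟨a, b, ha, hb, hab⟩ := exists_coe_le_of_coe_le_add hn
  rw [coe_le_dwt_iff] at ha hb ⊢
  exact antitone_intCast_mem_SigmaSet _ hab (by exact_mod_cast mul_mem_SigmaSet ha hb)

theorem min_dwt_le_dwt_add (f g : ℍ → ℂ) : min (dwt f) (dwt g) ≤ dwt (f + g) := by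
  refine le_of_forall_coe_le fun n hn ↦ ?_
  rw [le_min_iff, coe_le_dwt_iff, coe_le_dwt_iff] at hn
  exact coe_le_dwt_iff.mpr (add_mem_SigmaSet hn.1 hn.2)

theorem dwt_neg (f : ℍ → ℂ) : dwt (-f) = dwt f := by
  have hle (f : ℍ → ℂ) : dwt f ≤ dwt (-f) := le_of_forall_coe_le fun _ hn ↦
    coe_le_dwt_iff.mpr (neg_mem_SigmaSet (coe_le_dwt_iff.mp hn))
  exact le_antisymm (by simpa only [neg_neg] using hle (-f)) (hle f)

theorem dwt_add_eq_of_lt (h : dwt g < dwt f) : dwt (f + g) = dwt g := by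
  refine le_antisymm ?_ (by simpa only [min_eq_right h.le] using min_dwt_le_dwt_add f g)
  by_contra! hlt
  have hmin := min_dwt_le_dwt_add (f + g) (-f)
  rw [dwt_neg, add_neg_cancel_comm] at hmin
  exact (lt_min hlt h).not_ge hmin

theorem IsQuasimodular.dwt_eq {k s : ℕ} (h : IsQuasimodular k s f) (hf : f ≠ 0) :
    dwt f = (((k - s : ℤ) : WithTop ℤ) : WithBot (WithTop ℤ)) := by
  refine (dwt_eq_coe_iff f _).mpr ⟨(h.mem_SigmaSet_iff hf).mpr ⟨0, by simp⟩, fun m hm ↦ ?_⟩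
  obtain ⟨n, hn⟩ := (h.mem_SigmaSet_iff hf).mp hm
  have : m = k - s - n := by exact_mod_cast hn
  lia

end DifferentialWeight

end MLDE

end

theorem mainTheorem2_general :
    (∀ f g : ℍ → ℂ, MLDE.dwt f + MLDE.dwt g ≤ MLDE.dwt (f * g)) ∧
    (∀ f g : ℍ → ℂ, min (MLDE.dwt f) (MLDE.dwt g) ≤ MLDE.dwt (f + g)) ∧
    (∀ f g : ℍ → ℂ, MLDE.dwt g < MLDE.dwt f → MLDE.dwt (f + g) = MLDE.dwt g) ∧
    (∀ (k s : ℕ) (f : ℍ → ℂ), f ≠ 0 → MLDE.IsQuasimodular k s f →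
      MLDE.dwt f = (((k - s : ℤ) : WithTop ℤ) : WithBot (WithTop ℤ)) ∧
      ∀ m : ℝ, f ∈ MLDE.SigmaSet m ↔ ∃ n : ℕ, m = k - s - n) :=
  ⟨MLDE.dwt_add_dwt_le_dwt_mul, MLDE.min_dwt_le_dwt_add, fun _ _ ↦ MLDE.dwt_add_eq_of_lt,
    fun _ _ _ hf h ↦ ⟨h.dwt_eq hf, fun _ ↦ h.mem_SigmaSet_iff hf⟩⟩

theorem mainTheorem2 :
    (∀ f g : ℍ → ℂ, MDiff f → MDiff g →
      MLDE.dwt f + MLDE.dwt g ≤ MLDE.dwt (f * g)) ∧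
    (∀ f g : ℍ → ℂ, MDiff f → MDiff g → MLDE.dwt f = MLDE.dwt g →
      MLDE.dwt g ≤ MLDE.dwt (f + g)) ∧
    (∀ f g : ℍ → ℂ, MDiff f → MDiff g → MLDE.dwt g < MLDE.dwt f →
      MLDE.dwt (f + g) = MLDE.dwt g) ∧
    (∀ (k s : ℕ) (f : ℍ → ℂ), f ≠ 0 → MLDE.IsQuasimodular k s f →
      MLDE.dwt f = ((((k : ℤ) - (s : ℤ) : ℤ) : WithTop ℤ) : WithBot (WithTop ℤ)) ∧
      f ∈ MLDE.SigmaSet (((k : ℤ) - (s : ℤ) : ℤ) : ℝ) ∧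
      ∀ m : ℤ, (k : ℤ) - (s : ℤ) < m → f ∉ MLDE.SigmaSet (m : ℝ)) := by
  obtain ⟨hmul, hadd, hadd_eq, hquasi⟩ := mainTheorem2_general
  refine ⟨fun f g _ _ ↦ hmul f g, fun f g _ _ h ↦ by simpa only [h, min_self] using hadd f g,
    fun f g _ _ ↦ hadd_eq f g, fun k s f hf h ↦ ?_⟩
  have hdwt := (hquasi k s f hf h).1
  have hgreatest := (MLDE.dwt_eq_coe_iff f _).mp hdwt
  exact ⟨hdwt, hgreatest.1, fun _ hlt hmem ↦ hlt.not_ge (hgreatest.2 hmem)⟩
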